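/- Let $T$ be a topological space and, for each $t\in T$, let $A_t$ be a (possibly unbounded) self-adjoint operator on a complex Hilbert space $\mathcal H_t$, with spectrum $\sigma(A_t)\subseteq\mathbb R$. Then the following are equivalent. (i) $A=(A_t)_{t\in T}$ is R-continuous: for every $z\in\mathbb C\setminus\mathbb R$ the map $t\mapsto\|(z-A_t)^{-1}\|$ is continuous on $T$. (ii) The map $t\mapsto\sigma(A_t)$ is continuous for the Fell topology on the closed subsets of $\mathbb R$, i.e. the topology whose open sets are the unions of the sets $\{F \text{ closed} : F\cap K=\emptyset,\ F\cap O\neq\emptyset \text{ for all } O\in\mathcal F\}$ with $K\subseteq\mathbb R$ compact and $\mathcal F$ a finite family of open subsets of $\mathbb R$. (iii) The spectral edges are continuous, in the following sense. For a closed set $F\subseteq\mathbb R$, call $(a,b)$ with $-\infty\le a<b\le+\infty$ a complementary interval of $F$ if it is a connected component of $\mathbb R\setminus F$, that is, $(a,b)\cap F=\emptyset$, $a\in F$ or $a=-\infty$, and $b\in F$ or $b=+\infty$; its edges are $a$ and $b$. With $F_t=\sigma(A_t)$, and with limits of edges taken in $[-\infty,+\infty]$, it is required that for every $t_0\in T$: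 - for every complementary interval $(a,b)$ of $F_{t_0}$, every neighbourhood $U$ of $a$ and every neighbourhood $V$ of $b$ in $[-\infty,+\infty]$, there is a neighbourhood of $t_0$ such that for each $t$ in it $F_t$ has a complementary interval $(a_t,b_t)$ with $a_t\in U$ and $b_t\in V$; - if $U\subseteq T$ satisfies $t_0\in\overline U\setminus U$, if $(a_t,b_t)$ is a complementary interval of $F_t$ for each $t\in U$, and if $(a,b)$ is a limit point of $(a_t,b_t)$ as $t\to t_0$ in $U$, then $(a,b)$ is a complementary interval of $F_{t_0}$ when $a<b$, and $a\in F_{t_0}$ when $a=b\in\mathbb R$. -/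

import Mathlib

open Filter Topology TopologicalSpace

noncomputable section

namespace SpectralField

section Operators

variable {E : Type*} [NormedAddCommGroup E] [InnerProductSpace ℂ E]

/-- `R` is the bounded (everywhere defined) two-sided inverse of `z - A : dom A → E`. -/
def IsResolventAt (A : E →ₗ.[ℂ] E) (z : ℂ) (R : E →L[ℂ] E) : Prop :=
  (∀ y : E, ∃ h : R y ∈ A.domain, z • R y - A ⟨R y, h⟩ = y) ∧
    ∀ x : A.domain, R (z • (x : E) - A x) = x

/-- The resolvent set of a possibly unbounded operator. -/
def resolventSet (A : E →ₗ.[ℂ] E) : Set ℂ :=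
  {z | ∃ R : E →L[ℂ] E, IsResolventAt A z R}

open Classical in
/-- The resolvent `(z - A)⁻¹` for `z` in the resolvent set (and `0` elsewhere). -/
def resolvent (A : E →ₗ.[ℂ] E) (z : ℂ) : E →L[ℂ] E :=
  if h : z ∈ resolventSet A then h.choose else 0

/-- The spectrum of a possibly unbounded operator. -/
def spectrum (A : E →ₗ.[ℂ] E) : Set ℂ := (resolventSet A)ᶜ

theorem isOpen_resolventSet [CompleteSpace E] (A : E →ₗ.[ℂ] E) : IsOpen (resolventSet A) := by
  rw [Metric.isOpen_iff]
  rintro z ⟨R, hR₁, hR₂⟩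
  refine ⟨(‖R‖ + 1)⁻¹, by positivity, fun w hw => ?_⟩
  have hsmall : ‖(z - w) • R‖ < 1 := by
    rw [norm_smul]
    rw [Metric.mem_ball, dist_comm, dist_eq_norm] at hw
    calc ‖z - w‖ * ‖R‖ ≤ ‖z - w‖ * (‖R‖ + 1) := by gcongr; linarith
      _ < (‖R‖ + 1)⁻¹ * (‖R‖ + 1) := by gcongr
      _ = 1 := inv_mul_cancel₀ (by positivity)
  let S : (E →L[ℂ] E)ˣ := Units.oneSub _ hsmall
  have hS : ∀ y : E, (S : E →L[ℂ] E) y = y - (z - w) • R y := fun y => by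
    simp [S]
  have hS₁ : ∀ y : E, (S : E →L[ℂ] E) ((↑S⁻¹ : E →L[ℂ] E) y) = y := fun y =>
    DFunLike.congr_fun (Units.mul_inv S) y
  have hS₂ : ∀ y : E, (↑S⁻¹ : E →L[ℂ] E) ((S : E →L[ℂ] E) y) = y := fun y =>
    DFunLike.congr_fun (Units.inv_mul S) y
  refine ⟨R.comp (↑S⁻¹ : E →L[ℂ] E), fun y => ?_, fun x => ?_⟩
  · obtain ⟨h, e⟩ := hR₁ ((↑S⁻¹ : E →L[ℂ] E) y)
    refine ⟨h, ?_⟩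
    have e' := hS₁ y
    rw [hS, sub_smul] at e'
    have e₂ := sub_eq_iff_eq_add.mp e
    change w • R ((↑S⁻¹ : E →L[ℂ] E) y) - A ⟨R ((↑S⁻¹ : E →L[ℂ] E) y), h⟩ = y
    rw [e₂] at e'
    rw [← sub_eq_zero, ← sub_eq_zero.mpr e']
    abel
  · have hx := hR₂ x
    have key : w • (x : E) - A x = (S : E →L[ℂ] E) (z • (x : E) - A x) := by
      rw [hS, hx, sub_smul]; abel
    rw [ContinuousLinearMap.comp_apply, key, hS₂, hx]

/-- The spectrum, read as a closed subset of the real line (the spectrum of a self-adjoint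
operator has no other points). -/
def realSpectrum [CompleteSpace E] (A : E →ₗ.[ℂ] E) : Closeds ℝ where
  carrier := {x : ℝ | (x : ℂ) ∈ spectrum A}
  isClosed' := (isOpen_resolventSet A).isClosed_compl.preimage Complex.continuous_ofReal

end Operators

section Fell

/-- The closed sets that miss `K` and hit every member of `𝓕`. -/
def hitAndMiss {X : Type*} [TopologicalSpace X] (K : Set X) (𝓕 : Set (Set X)) :
    Set (Closeds X) :=
  {F | K ∩ (F : Set X) = ∅ ∧ ∀ O ∈ 𝓕, ((F : Set X) ∩ O).Nonempty}

/-- The Fell topology on the closed subsets of `X`. -/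
abbrev fellTopology (X : Type*) [TopologicalSpace X] : TopologicalSpace (Closeds X) :=
  TopologicalSpace.generateFrom
    {W | ∃ (K : Set X) (𝓕 : Set (Set X)), IsCompact K ∧ 𝓕.Finite ∧ (∀ O ∈ 𝓕, IsOpen O) ∧
      W = hitAndMiss K 𝓕}

end Fell

section Edges

/-- `(a, b)`, with `-∞ ≤ a < b ≤ +∞`, is a connected component of the complement of the closed
set `F ⊆ ℝ`: it does not meet `F`, and each of its two edges is a point of `F` or infinite. -/
def IsComplementInterval (F : Set ℝ) (a b : EReal) : Prop :=
  a < b ∧ (∀ x ∈ F, ¬(a < (x : EReal) ∧ (x : EReal) < b)) ∧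
    (a = ⊥ ∨ ∃ x ∈ F, (x : EReal) = a) ∧ (b = ⊤ ∨ ∃ x ∈ F, (x : EReal) = b)

variable {T : Type*} [TopologicalSpace T]

/-- Continuity at `t₀` of the edges of a family of closed subsets of `ℝ`, where an edge may be
infinite. `persist`: each complementary interval of `F t₀` is a limit of complementary intervals
of `F t`. `limit`: each limit point `(a, b)`, as `t → t₀`, of complementary intervals of `F t` is
a complementary interval of `F t₀` or, when it has closed at a real number, a point of `F t₀`. -/
structure EdgesContinuousAt (F : T → Set ℝ) (t₀ : T) : Prop where
  persist : ∀ a b : EReal, IsComplementInterval (F t₀) a b →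
    ∀ U ∈ 𝓝 a, ∀ V ∈ 𝓝 b, ∀ᶠ t in 𝓝 t₀,
      ∃ a' ∈ U, ∃ b' ∈ V, IsComplementInterval (F t) a' b'
  limit : ∀ (U : Set T) (α β : T → EReal), t₀ ∈ closure U \ U →
    (∀ t ∈ U, IsComplementInterval (F t) (α t) (β t)) →
    ∀ a b : EReal, MapClusterPt (a, b) (𝓝[U] t₀) (fun t => (α t, β t)) →
      (a < b → IsComplementInterval (F t₀) a b) ∧
        (∀ c : ℝ, a = (c : EReal) → b = (c : EReal) → c ∈ F t₀)

/-- The edges of the family are continuous at every parameter. -/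
def EdgesContinuous (F : T → Set ℝ) : Prop := ∀ t₀ : T, EdgesContinuousAt F t₀

end Edges

section Fields

variable {T : Type*} [TopologicalSpace T] {H : T → Type*} [∀ t, NormedAddCommGroup (H t)]
  [∀ t, InnerProductSpace ℂ (H t)]

/-- A field of operators is R-continuous if, for each non-real `z`, the norm of the resolvent
at `z` is a continuous function of the parameter. -/
def RContinuous (A : ∀ t, H t →ₗ.[ℂ] H t) : Prop :=
  ∀ z : ℂ, z.im ≠ 0 → Continuous fun t => ‖resolvent (A t) z‖

end Fields

end SpectralField

end

/-! Everything rests on ‖(z - A)⁻¹‖ = dist(z, σ(A))⁻¹ for self-adjoint `A` and non-real `z`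
(`ofReal_norm_resolvent`). The resolvent is normal, so its norm is its spectral radius, and a
spectral value μ of maximal modulus gives the spectral point z - μ⁻¹ at distance ‖R‖⁻¹; the opposite
bound is the Neumann series. Hence R-continuity says that t ↦ dist(z, σ(A_t)) is continuous for each
non-real z.

The rest concerns closed subsets of ℝ. A distance is below r when an open set is hit and above s
when a compact set is missed, so Fell continuity gives continuous distances. Conversely, the
distance from x + ir tells whether F has points near x.

For edges, the gap around m ∉ F has a supremum and an infimum of points of F as its edges, and hit
and miss conditions control both. Conversely, persistence of gaps gives the miss conditions. If a
hit condition failed, compactness of the extended line would produce a limit gap containing a point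
of F_{t₀}. -/

namespace SpectralField

/-! ### Fell continuity and distance functions -/

section FellCriteria

variable {T : Type*} [TopologicalSpace T]

theorem eventually_hit_of_continuous_fell {X : Type*} [TopologicalSpace X] {F : T → Closeds X}
    (hF : Continuous[_, fellTopology X] F) {t₀ : T} {O : Set X} (hO : IsOpen O)
    (h : ((F t₀ : Set X) ∩ O).Nonempty) : ∀ᶠ t in 𝓝 t₀, ((F t : Set X) ∩ O).Nonempty := by
  have := continuous_generateFrom_iff.mp hF (hitAndMiss ∅ {O})
    ⟨∅, {O}, isCompact_empty, Set.finite_singleton _, by simpa using hO, rfl⟩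
  filter_upwards [this.mem_nhds (x := t₀) (by simpa [hitAndMiss] using h)] with t ht
  simpa [hitAndMiss] using ht

theorem eventually_miss_of_continuous_fell {X : Type*} [TopologicalSpace X] {F : T → Closeds X}
    (hF : Continuous[_, fellTopology X] F) {t₀ : T} {K : Set X} (hK : IsCompact K)
    (h : ∀ x ∈ K, x ∉ F t₀) : ∀ᶠ t in 𝓝 t₀, ∀ x ∈ K, x ∉ F t := by
  have := continuous_generateFrom_iff.mp hF (hitAndMiss K ∅)
    ⟨K, ∅, hK, Set.finite_empty, by simp, rfl⟩
  have h0 : K ∩ (F t₀ : Set X) = ∅ := by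
    ext x
    simpa using h x
  filter_upwards [this.mem_nhds (x := t₀) ⟨h0, by simp⟩] with t ht x hx hx'
  exact Set.eq_empty_iff_forall_notMem.mp ht.1 x ⟨hx, hx'⟩

/-- Continuity for the Fell topology, tested on points. -/
theorem continuous_fell_of_pointwise {X : Type*} [TopologicalSpace X] {F : T → Closeds X}
    (hit : ∀ t₀, ∀ x ∈ F t₀, ∀ O : Set X, IsOpen O → x ∈ O →
      ∀ᶠ t in 𝓝 t₀, ((F t : Set X) ∩ O).Nonempty)
    (miss : ∀ t₀, ∀ x, x ∉ F t₀ → ∃ N ∈ 𝓝 x, ∀ᶠ t in 𝓝 t₀, ∀ y ∈ N, y ∉ F t) :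
    Continuous[_, fellTopology X] F := by
  refine continuous_generateFrom_iff.mpr ?_
  rintro W ⟨K, 𝓕, hK, h𝓕, hO, rfl⟩
  rw [isOpen_iff_mem_nhds]
  rintro t₀ ⟨hmiss, hhit⟩
  have h₁ : ∀ᶠ t in 𝓝 t₀, ∀ x ∈ K, x ∉ F t := by
    -- Compactness glues the local misses into one neighbourhood of `t₀`.
    refine hK.induction_on (p := fun S => ∀ᶠ t in 𝓝 t₀, ∀ x ∈ S, x ∉ F t) (by simp)
      (fun s u hsu hu => hu.mono fun t ht x hx => ht x (hsu hx))
      (fun s u hs hu => ?_) fun x hx => ?_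
    · filter_upwards [hs, hu] with t hs hu x hx
      exact hx.elim (hs x) (hu x)
    · obtain ⟨N, hN, h⟩ := miss t₀ x fun hx' =>
        Set.eq_empty_iff_forall_notMem.mp hmiss x ⟨hx, hx'⟩
      exact ⟨N, mem_nhdsWithin_of_mem_nhds hN, h⟩
  have h₂ : ∀ᶠ t in 𝓝 t₀, ∀ O ∈ 𝓕, ((F t : Set X) ∩ O).Nonempty := by
    refine (eventually_all_finite h𝓕).mpr fun O hO' => ?_
    obtain ⟨x, hx, hxO⟩ := hhit O hO'
    exact hit t₀ x hx O (hO O hO') hxO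
  filter_upwards [h₁, h₂] with t h₁ h₂
  refine ⟨?_, h₂⟩
  ext x
  simpa using h₁ x

/-- The square of the distance from `x + iε` to the real point `y`. -/
theorem dist_mk_ofReal (x ε y : ℝ) : dist (⟨x, ε⟩ : ℂ) (y : ℂ) = √((x - y) ^ 2 + ε ^ 2) := by
  simp [Complex.dist_eq_re_im]

/-- Test at z = x + ir with threshold 5r/4. By Pythagoras, distance r (when x ∈ F) lies below it,
and a point of F closer to z than 5r/4 is within 3r/4 of x. If F misses the r-ball about x, the
distance is at least √2 r > 4r/3 > 5r/4, whereas a point of F within r/2 of x would make it at most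
√5 r/2 < 5r/4. -/
theorem continuous_fell_of_continuous_infEDist {F : T → Closeds ℝ}
    (h : ∀ z : ℂ, z.im ≠ 0 →
      Continuous fun t => Metric.infEDist z (Complex.ofReal '' (F t : Set ℝ))) :
    Continuous[_, fellTopology ℝ] F := by
  refine continuous_fell_of_pointwise (fun t₀ x hx O hO hxO => ?_) fun t₀ x hx => ?_
  · obtain ⟨r, hr, hball⟩ := Metric.isOpen_iff.mp hO x hxO
    have hlt : Metric.infEDist (⟨x, r⟩ : ℂ) (Complex.ofReal '' (F t₀ : Set ℝ)) <
        ENNReal.ofReal (5 / 4 * r) := by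
      refine Metric.infEDist_lt_iff.mpr ⟨x, ⟨x, hx, rfl⟩, ?_⟩
      rw [edist_dist, dist_mk_ofReal]
      refine (ENNReal.ofReal_lt_ofReal_iff (by positivity)).mpr ?_
      rw [Real.sqrt_lt' (by positivity)]
      nlinarith
    filter_upwards [(h ⟨x, r⟩ hr.ne').continuousAt.eventually_lt_const hlt] with t ht
    obtain ⟨_, ⟨y, hy, rfl⟩, hlt'⟩ := Metric.infEDist_lt_iff.mp ht
    refine ⟨y, hy, hball ?_⟩
    rw [edist_dist, dist_mk_ofReal, ENNReal.ofReal_lt_ofReal_iff (by positivity),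
      Real.sqrt_lt' (by positivity)] at hlt'
    rw [Metric.mem_ball, Real.dist_eq]
    refine abs_lt_of_sq_lt_sq ?_ hr.le
    nlinarith
  · obtain ⟨r, hr, hball⟩ := Metric.isOpen_iff.mp (F t₀).isClosed.isOpen_compl x hx
    have hlt : ENNReal.ofReal (5 / 4 * r) <
        Metric.infEDist (⟨x, r⟩ : ℂ) (Complex.ofReal '' (F t₀ : Set ℝ)) := by
      have h' : ENNReal.ofReal (4 / 3 * r) ≤
          Metric.infEDist (⟨x, r⟩ : ℂ) (Complex.ofReal '' (F t₀ : Set ℝ)) := by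
        rw [Metric.le_infEDist]
        rintro _ ⟨y, hy, rfl⟩
        rw [edist_dist, dist_mk_ofReal]
        refine ENNReal.ofReal_le_ofReal (Real.le_sqrt_of_sq_le ?_)
        have hry : r ≤ |x - y| := by
          by_contra! hlt
          exact hball (by rwa [Metric.mem_ball, dist_comm, Real.dist_eq]) hy
        have := sq_le_sq' (by linarith) hry
        rw [sq_abs] at this
        nlinarith
      refine lt_of_lt_of_le ?_ h'
      exact (ENNReal.ofReal_lt_ofReal_iff (by positivity)).mpr (by linarith)
    refine ⟨Metric.ball x (r / 2), Metric.ball_mem_nhds x (by positivity), ?_⟩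
    filter_upwards [(h ⟨x, r⟩ hr.ne').continuousAt.eventually_const_lt hlt] with t ht y hy hyF
    refine ht.not_gt (Metric.infEDist_lt_iff.mpr ⟨y, ⟨y, hyF, rfl⟩, ?_⟩)
    rw [edist_dist, dist_mk_ofReal]
    refine (ENNReal.ofReal_lt_ofReal_iff (by positivity)).mpr ?_
    rw [Real.sqrt_lt' (by positivity)]
    rw [Metric.mem_ball, dist_comm, Real.dist_eq] at hy
    have := sq_lt_sq' (by linarith [abs_nonneg (x - y)]) hy
    rw [sq_abs] at this
    nlinarith

theorem continuous_infEDist_of_continuous_fell {F : T → Closeds ℝ}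
    (hF : Continuous[_, fellTopology ℝ] F) (z : ℂ) :
    Continuous fun t => Metric.infEDist z (Complex.ofReal '' (F t : Set ℝ)) := by
  refine continuous_iff_continuousAt.mpr fun t₀ => tendsto_order.mpr ⟨fun r hr => ?_, fun r hr => ?_⟩
  -- A finite radius s below the distance gives a closed disc with compact trace on ℝ, disjoint from
  -- `F t₀`.
  · obtain ⟨s, hrs, hs⟩ := ENNReal.lt_iff_exists_nnreal_btwn.mp hr
    have hK : IsCompact (Complex.ofReal ⁻¹' Metric.closedBall z s) :=
      Complex.isometry_ofReal.isClosedEmbedding.isCompact_preimage (isCompact_closedBall z s)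
    have hm := eventually_miss_of_continuous_fell hF (t₀ := t₀) hK fun x hx hx' => by
      refine absurd (Metric.infEDist_le_edist_of_mem (x := z)
        (Set.mem_image_of_mem Complex.ofReal hx')) (not_le.mpr (lt_of_le_of_lt ?_ hs))
      rw [edist_nndist]
      exact_mod_cast (dist_comm z _).trans_le hx
    filter_upwards [hm] with t ht
    refine hrs.trans_le (Metric.le_infEDist.mpr ?_)
    rintro _ ⟨y, hy, rfl⟩
    by_contra! hlt
    refine ht y ?_ hy
    rw [edist_nndist] at hlt
    rw [Set.mem_preimage, Metric.mem_closedBall, dist_comm]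
    exact_mod_cast hlt.le
  · obtain ⟨_, ⟨y, hy, rfl⟩, hlt⟩ := Metric.infEDist_lt_iff.mp hr
    have hO : IsOpen {x : ℝ | edist z (x : ℂ) < r} :=
      isOpen_lt (by fun_prop) continuous_const
    filter_upwards [eventually_hit_of_continuous_fell hF (t₀ := t₀) hO ⟨y, hy, hlt⟩] with t ht
    obtain ⟨x, hx, hxr⟩ := ht
    exact Metric.infEDist_lt_iff.mpr ⟨x, ⟨x, hx, rfl⟩, hxr⟩

end FellCriteria

/-! ### Edges of the gap around a point -/

section EdgesOfClosedSets

/-- The left edge of the complementary interval of `F` that contains `m`. -/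
noncomputable def lowerEdge (F : Set ℝ) (m : ℝ) : EReal :=
  sSup ((↑) '' {x ∈ F | x < m})

/-- The right edge of the complementary interval of `F` that contains `m`. -/
noncomputable def upperEdge (F : Set ℝ) (m : ℝ) : EReal :=
  sInf ((↑) '' {x ∈ F | m < x})

variable {F : Set ℝ} {m : ℝ}

theorem le_lowerEdge {x : ℝ} (hx : x ∈ F) (hm : x < m) : (x : EReal) ≤ lowerEdge F m :=
  le_sSup ⟨x, ⟨hx, hm⟩, rfl⟩

theorem upperEdge_le {x : ℝ} (hx : x ∈ F) (hm : m < x) : upperEdge F m ≤ (x : EReal) :=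
  sInf_le ⟨x, ⟨hx, hm⟩, rfl⟩

theorem lowerEdge_le_of_Icc {r : ℝ} (h : ∀ x ∈ Set.Icc r m, x ∉ F) :
    lowerEdge F m ≤ (r : EReal) := by
  refine sSup_le ?_
  rintro _ ⟨x, ⟨hx, hxm⟩, rfl⟩
  by_contra! hlt
  exact h x ⟨(EReal.coe_lt_coe_iff.mp hlt).le, hxm.le⟩ hx

theorem le_upperEdge_of_Icc {r : ℝ} (h : ∀ x ∈ Set.Icc m r, x ∉ F) :
    (r : EReal) ≤ upperEdge F m := by
  refine le_sInf ?_
  rintro _ ⟨x, ⟨hx, hxm⟩, rfl⟩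
  by_contra! hlt
  exact h x ⟨hxm.le, (EReal.coe_lt_coe_iff.mp hlt).le⟩ hx

theorem exists_Icc_disjoint (hF : IsClosed F) (hm : m ∉ F) :
    ∃ ε > 0, ∀ x ∈ Set.Icc (m - ε) (m + ε), x ∉ F := by
  obtain ⟨ε, hε, h⟩ := Metric.nhds_basis_closedBall.mem_iff.mp (hF.isOpen_compl.mem_nhds hm)
  exact ⟨ε, hε, fun x hx => h (by rwa [Real.closedBall_eq_Icc])⟩

theorem lowerEdge_lt (hF : IsClosed F) (hm : m ∉ F) : lowerEdge F m < m := by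
  obtain ⟨ε, hε, h⟩ := exists_Icc_disjoint hF hm
  refine (lowerEdge_le_of_Icc (r := m - ε) fun x hx => h x ⟨hx.1, by linarith [hx.2]⟩).trans_lt ?_
  exact EReal.coe_lt_coe_iff.mpr (by linarith)

theorem lt_upperEdge (hF : IsClosed F) (hm : m ∉ F) : (m : EReal) < upperEdge F m := by
  obtain ⟨ε, hε, h⟩ := exists_Icc_disjoint hF hm
  refine lt_of_lt_of_le ?_
    (le_upperEdge_of_Icc (r := m + ε) fun x hx => h x ⟨by linarith [hx.1], hx.2⟩)
  exact EReal.coe_lt_coe_iff.mpr (by linarith)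

theorem lowerEdge_eq_bot_or_mem (hF : IsClosed F) :
    lowerEdge F m = ⊥ ∨ ∃ x ∈ F, (x : EReal) = lowerEdge F m := by
  have hle : lowerEdge F m ≤ m := sSup_le <| by
    rintro _ ⟨x, ⟨-, hx⟩, rfl⟩
    exact EReal.coe_le_coe_iff.mpr hx.le
  rcases eq_or_ne (lowerEdge F m) ⊥ with h | h
  · exact Or.inl h
  right
  lift lowerEdge F m to ℝ using ⟨ne_top_of_le_ne_top (EReal.coe_ne_top m) hle, h⟩ with l hl
  refine ⟨l, ?_, rfl⟩
  by_contra hlF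
  obtain ⟨ε, hε, hd⟩ := exists_Icc_disjoint hF hlF
  have hlt : ((l - ε : ℝ) : EReal) < lowerEdge F m := by
    rw [← hl]
    exact EReal.coe_lt_coe_iff.mpr (by linarith)
  obtain ⟨_, ⟨x, ⟨hx, hxm⟩, rfl⟩, hlx⟩ := lt_sSup_iff.mp hlt
  have hxl : (x : EReal) ≤ l := hl ▸ le_lowerEdge hx hxm
  exact hd x ⟨(EReal.coe_lt_coe_iff.mp hlx).le,
    by linarith [EReal.coe_le_coe_iff.mp hxl]⟩ hx

theorem upperEdge_eq_top_or_mem (hF : IsClosed F) :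
    upperEdge F m = ⊤ ∨ ∃ x ∈ F, (x : EReal) = upperEdge F m := by
  have hle : (m : EReal) ≤ upperEdge F m := le_sInf <| by
    rintro _ ⟨x, ⟨-, hx⟩, rfl⟩
    exact EReal.coe_le_coe_iff.mpr hx.le
  rcases eq_or_ne (upperEdge F m) ⊤ with h | h
  · exact Or.inl h
  right
  lift upperEdge F m to ℝ using ⟨h, ne_bot_of_le_ne_bot (EReal.coe_ne_bot m) hle⟩ with l hl
  refine ⟨l, ?_, rfl⟩
  by_contra hlF
  obtain ⟨ε, hε, hd⟩ := exists_Icc_disjoint hF hlF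
  have hlt : upperEdge F m < ((l + ε : ℝ) : EReal) := by
    rw [← hl]
    exact EReal.coe_lt_coe_iff.mpr (by linarith)
  obtain ⟨_, ⟨x, ⟨hx, hxm⟩, rfl⟩, hlx⟩ := sInf_lt_iff.mp hlt
  have hxl : (l : EReal) ≤ x := hl ▸ upperEdge_le hx hxm
  exact hd x ⟨by linarith [EReal.coe_le_coe_iff.mp hxl],
    (EReal.coe_lt_coe_iff.mp hlx).le⟩ hx

theorem isComplementInterval_edges (hF : IsClosed F) (hm : m ∉ F) :
    IsComplementInterval F (lowerEdge F m) (upperEdge F m) := by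
  refine ⟨(lowerEdge_lt hF hm).trans (lt_upperEdge hF hm), fun x hx h => ?_,
    lowerEdge_eq_bot_or_mem hF, upperEdge_eq_top_or_mem hF⟩
  rcases lt_trichotomy x m with h' | rfl | h'
  · exact (le_lowerEdge hx h').not_gt h.1
  · exact hm hx
  · exact (upperEdge_le hx h').not_gt h.2

/-- A gap is determined by any one of its points, so arbitrary gaps can be tracked through edge
functions at a fixed m. -/
theorem IsComplementInterval.eq_lowerEdge {a b : EReal} (h : IsComplementInterval F a b)
    (ha : a < m) (hb : (m : EReal) < b) : a = lowerEdge F m := by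
  refine le_antisymm ?_ (sSup_le ?_)
  · rcases h.2.2.1 with rfl | ⟨x, hx, rfl⟩
    · exact bot_le
    · exact le_lowerEdge hx (EReal.coe_lt_coe_iff.mp ha)
  · rintro _ ⟨x, ⟨hx, hxm⟩, rfl⟩
    by_contra! hlt
    exact h.2.1 x hx ⟨hlt, (EReal.coe_lt_coe_iff.mpr hxm).trans hb⟩

theorem IsComplementInterval.eq_upperEdge {a b : EReal} (h : IsComplementInterval F a b)
    (ha : a < m) (hb : (m : EReal) < b) : b = upperEdge F m := by
  refine le_antisymm (le_sInf ?_) ?_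
  · rintro _ ⟨x, ⟨hx, hxm⟩, rfl⟩
    by_contra! hlt
    exact h.2.1 x hx ⟨ha.trans (EReal.coe_lt_coe_iff.mpr hxm), hlt⟩
  · rcases h.2.2.2 with rfl | ⟨x, hx, rfl⟩
    · exact le_top
    · exact upperEdge_le hx (EReal.coe_lt_coe_iff.mp hb)

end EdgesOfClosedSets

/-! ### Fell continuity and continuity of edges -/

section ContinuityOfEdges

variable {T : Type*} [TopologicalSpace T] {F : T → Closeds ℝ}

/-- Lower bounds on the supremum persist because a point of `F t₀` in an open set is an open hit
condition; upper bounds persist because [r, m] is compact and missed. -/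
theorem tendsto_lowerEdge (hF : Continuous[_, fellTopology ℝ] F) {t₀ : T} {m : ℝ}
    (hm : m ∉ F t₀) :
    Tendsto (fun t => lowerEdge (F t : Set ℝ) m) (𝓝 t₀) (𝓝 (lowerEdge (F t₀ : Set ℝ) m)) := by
  refine tendsto_order.mpr ⟨fun p hp => ?_, fun q hq => ?_⟩
  · obtain ⟨_, ⟨x, ⟨hx, hxm⟩, rfl⟩, hpx⟩ := lt_sSup_iff.mp hp
    have hO : IsOpen {y : ℝ | p < (y : EReal) ∧ y < m} :=
      (isOpen_lt continuous_const continuous_coe_real_ereal).inter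
        (isOpen_lt continuous_id continuous_const)
    filter_upwards [eventually_hit_of_continuous_fell hF hO ⟨x, hx, hpx, hxm⟩] with t ht
    obtain ⟨y, hy, hpy, hym⟩ := ht
    exact hpy.trans_le (le_lowerEdge hy hym)
  · obtain ⟨r, hr, hrq⟩ := EReal.lt_iff_exists_real_btwn.mp hq
    have hmiss := eventually_miss_of_continuous_fell hF (t₀ := t₀) (isCompact_Icc (a := r) (b := m))
      fun x hx hxF => by
        rcases hx.2.eq_or_lt with rfl | hlt
        · exact hm hxF
        · exact ((le_lowerEdge hxF hlt).trans_lt hr).not_ge (EReal.coe_le_coe_iff.mpr hx.1)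
    filter_upwards [hmiss] with t ht
    exact (lowerEdge_le_of_Icc ht).trans_lt hrq

theorem tendsto_upperEdge (hF : Continuous[_, fellTopology ℝ] F) {t₀ : T} {m : ℝ}
    (hm : m ∉ F t₀) :
    Tendsto (fun t => upperEdge (F t : Set ℝ) m) (𝓝 t₀) (𝓝 (upperEdge (F t₀ : Set ℝ) m)) := by
  refine tendsto_order.mpr ⟨fun q hq => ?_, fun p hp => ?_⟩
  · obtain ⟨r, hqr, hr⟩ := EReal.lt_iff_exists_real_btwn.mp hq
    have hmiss := eventually_miss_of_continuous_fell hF (t₀ := t₀) (isCompact_Icc (a := m) (b := r))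
      fun x hx hxF => by
        rcases hx.1.eq_or_lt with rfl | hlt
        · exact hm hxF
        · exact (hr.trans_le (upperEdge_le hxF hlt)).not_ge (EReal.coe_le_coe_iff.mpr hx.2)
    filter_upwards [hmiss] with t ht
    exact hqr.trans_le (le_upperEdge_of_Icc ht)
  · obtain ⟨_, ⟨x, ⟨hx, hxm⟩, rfl⟩, hpx⟩ := sInf_lt_iff.mp hp
    have hO : IsOpen {y : ℝ | (y : EReal) < p ∧ m < y} :=
      (isOpen_lt continuous_coe_real_ereal continuous_const).inter
        (isOpen_lt continuous_const continuous_id)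
    filter_upwards [eventually_hit_of_continuous_fell hF hO ⟨x, hx, hpx, hxm⟩] with t ht
    obtain ⟨y, hy, hpy, hym⟩ := ht
    exact (upperEdge_le hy hym).trans_lt hpy

/-- A real limit point of real points of `F t` or infinite values is a point of `F t₀`. -/
theorem mem_of_mapClusterPt (hF : Continuous[_, fellTopology ℝ] F) {t₀ : T} {U : Set T}
    {γ : T → EReal} (hγ : ∀ t ∈ U, γ t = ⊥ ∨ γ t = ⊤ ∨ ∃ x ∈ F t, (x : EReal) = γ t) {c : ℝ}
    (hc : MapClusterPt (c : EReal) (𝓝[U] t₀) γ) : c ∈ F t₀ := by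
  by_contra hcF
  obtain ⟨ε, hε, hd⟩ := exists_Icc_disjoint (F t₀).isClosed hcF
  have hmiss := eventually_miss_of_continuous_fell hF (t₀ := t₀) isCompact_Icc hd
  have hN : Set.Ioo ((c - ε : ℝ) : EReal) ((c + ε : ℝ) : EReal) ∈ 𝓝 (c : EReal) :=
    Ioo_mem_nhds (EReal.coe_lt_coe_iff.mpr (by linarith)) (EReal.coe_lt_coe_iff.mpr (by linarith))
  obtain ⟨t, ht, htU, htm⟩ := ((hc.frequently hN).and_eventually
    (eventually_mem_nhdsWithin.and (hmiss.filter_mono nhdsWithin_le_nhds))).exists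
  rcases hγ t htU with h | h | ⟨x, hx, h⟩
  · exact not_lt_bot (h ▸ ht.1)
  · exact not_top_lt (h ▸ ht.2)
  · rw [← h] at ht
    exact htm x ⟨(EReal.coe_lt_coe_iff.mp ht.1).le, (EReal.coe_lt_coe_iff.mp ht.2).le⟩ hx

theorem edgesContinuous_of_continuous_fell (hF : Continuous[_, fellTopology ℝ] F) :
    EdgesContinuous fun t => (F t : Set ℝ) := by
  refine fun t₀ => ⟨fun a b hab U hU V hV => ?_, fun U α β ht₀ hαβ a b hcl => ?_⟩
  · obtain ⟨m, ham, hmb⟩ := EReal.lt_iff_exists_real_btwn.mp hab.1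
    have hm : m ∉ F t₀ := fun hm => hab.2.1 m hm ⟨ham, hmb⟩
    rw [hab.eq_lowerEdge ham hmb] at hU
    rw [hab.eq_upperEdge ham hmb] at hV
    filter_upwards [tendsto_lowerEdge hF hm hU, tendsto_upperEdge hF hm hV,
      eventually_miss_of_continuous_fell hF (isCompact_singleton (x := m))
        (by simpa using hm)] with t h₁ h₂ h₃
    exact ⟨_, h₁, _, h₂, isComplementInterval_edges (F t).isClosed (h₃ m rfl)⟩
  · have hclα : MapClusterPt a (𝓝[U] t₀) α := hcl.continuousAt_comp continuous_fst.continuousAt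
    have hclβ : MapClusterPt b (𝓝[U] t₀) β := hcl.continuousAt_comp continuous_snd.continuousAt
    have ha : ∀ c : ℝ, a = c → c ∈ F t₀ := fun c hc =>
      mem_of_mapClusterPt hF (fun t ht => (hαβ t ht).2.2.1.imp_right Or.inr) (hc ▸ hclα)
    have hb : ∀ c : ℝ, b = c → c ∈ F t₀ := fun c hc =>
      mem_of_mapClusterPt hF (fun t ht => Or.inr (hαβ t ht).2.2.2) (hc ▸ hclβ)
    refine ⟨fun hab => ⟨hab, fun x hx hx' => ?_, ?_, ?_⟩, fun c hc _ => ha c hc⟩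
    -- A point x of `F t₀` in (a, b) forces points of `F t` in (r, s), which frequently lies inside
    -- the gap (α t, β t).
    · obtain ⟨r, har, hrx⟩ := EReal.lt_iff_exists_real_btwn.mp hx'.1
      obtain ⟨s, hxs, hsb⟩ := EReal.lt_iff_exists_real_btwn.mp hx'.2
      have hhit := eventually_hit_of_continuous_fell hF (t₀ := t₀) (isOpen_Ioo (a := r) (b := s))
        ⟨x, hx, EReal.coe_lt_coe_iff.mp hrx, EReal.coe_lt_coe_iff.mp hxs⟩
      obtain ⟨t, ht, htU, y, hy, hry, hys⟩ := ((hcl.frequently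
        (prod_mem_nhds (Iio_mem_nhds har) (Ioi_mem_nhds hsb))).and_eventually
        (eventually_mem_nhdsWithin.and (hhit.filter_mono nhdsWithin_le_nhds))).exists
      exact (hαβ t htU).2.1 y hy ⟨lt_trans ht.1 (EReal.coe_lt_coe_iff.mpr hry),
        lt_trans (EReal.coe_lt_coe_iff.mpr hys) ht.2⟩
    · refine or_iff_not_imp_left.mpr fun h => ?_
      lift a to ℝ using ⟨hab.ne_top, h⟩
      exact ⟨a, ha a rfl, rfl⟩
    · refine or_iff_not_imp_left.mpr fun h => ?_
      lift b to ℝ using ⟨h, hab.ne_bot⟩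
      exact ⟨b, hb b rfl, rfl⟩

theorem continuous_fell_of_edgesContinuous (hF : EdgesContinuous fun t => (F t : Set ℝ)) :
    Continuous[_, fellTopology ℝ] F := by
  refine continuous_fell_of_pointwise (fun t₀ x hx O hO hxO => ?_) fun t₀ x hx => ?_
  · by_contra hnot
    -- The parameters where the hit fails; `t₀` is in the closure but not in `U`, as `limit`
    -- demands.
    let U : Set T := {t | ¬((F t : Set ℝ) ∩ O).Nonempty}
    have hcl : t₀ ∈ closure U := mem_closure_iff_frequently.mpr (not_eventually.mp hnot)
    have hxU : ∀ t ∈ U, x ∉ F t := fun t ht hxt => ht ⟨x, hxt, hxO⟩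
    have : (𝓝[U] t₀).NeBot := mem_closure_iff_nhdsWithin_neBot.mp hcl
    -- The gaps around x have a limit point, and all contain [x - ε, x + ε], so the limit cannot
    -- close up at x.
    obtain ⟨⟨a, b⟩, hab⟩ := exists_clusterPt_of_compactSpace
      (map (fun t => (lowerEdge (F t : Set ℝ) x, upperEdge (F t : Set ℝ) x)) (𝓝[U] t₀))
    obtain ⟨ε, hε, hball⟩ := Metric.nhds_basis_closedBall.mem_iff.mp (hO.mem_nhds hxO)
    rw [Real.closedBall_eq_Icc] at hball
    have hdisj : ∀ t ∈ U, ∀ y ∈ Set.Icc (x - ε) (x + ε), y ∉ F t := fun t ht y hy hyF =>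
      ht ⟨y, hyF, hball hy⟩
    have hmem : (a, b) ∈ Set.Iic ((x - ε : ℝ) : EReal) ×ˢ Set.Ici ((x + ε : ℝ) : EReal) := by
      refine (isClosed_Iic.prod isClosed_Ici).closure_subset
        (mem_closure_iff_clusterPt.mpr (hab.mono (le_principal_iff.mpr ?_)))
      refine mem_map.mpr ?_
      filter_upwards [self_mem_nhdsWithin] with t ht
      exact ⟨lowerEdge_le_of_Icc fun y hy => hdisj t ht y ⟨hy.1, by linarith [hy.2]⟩,
        le_upperEdge_of_Icc fun y hy => hdisj t ht y ⟨by linarith [hy.1], hy.2⟩⟩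
    have ha : a < x := lt_of_le_of_lt hmem.1 (EReal.coe_lt_coe_iff.mpr (by linarith))
    have hb : (x : EReal) < b := lt_of_lt_of_le (EReal.coe_lt_coe_iff.mpr (by linarith)) hmem.2
    have hlim := (hF t₀).limit U _ _ ⟨hcl, fun h => h ⟨x, hx, hxO⟩⟩
      (fun t ht => isComplementInterval_edges (F t).isClosed (hxU t ht)) a b hab
    exact (hlim.1 (ha.trans hb)).2.1 x hx ⟨ha, hb⟩
  · obtain ⟨ε, hε, hd⟩ := exists_Icc_disjoint (F t₀).isClosed hx
    have ha : lowerEdge (F t₀ : Set ℝ) x ≤ ((x - ε : ℝ) : EReal) :=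
      lowerEdge_le_of_Icc fun y hy => hd y ⟨hy.1, by linarith [hy.2]⟩
    have hb : ((x + ε : ℝ) : EReal) ≤ upperEdge (F t₀ : Set ℝ) x :=
      le_upperEdge_of_Icc fun y hy => hd y ⟨by linarith [hy.1], hy.2⟩
    refine ⟨Set.Ioo (x - ε / 2) (x + ε / 2), Ioo_mem_nhds (by linarith) (by linarith), ?_⟩
    filter_upwards [(hF t₀).persist _ _ (isComplementInterval_edges (F t₀).isClosed hx)
      (Set.Iio ((x - ε / 2 : ℝ) : EReal))
      (Iio_mem_nhds (ha.trans_lt (EReal.coe_lt_coe_iff.mpr (by linarith))))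
      (Set.Ioi ((x + ε / 2 : ℝ) : EReal))
      (Ioi_mem_nhds (lt_of_lt_of_le (EReal.coe_lt_coe_iff.mpr (by linarith)) hb))]
      with t ht y hy hyF
    obtain ⟨a, ha, b, hb, hab⟩ := ht
    exact hab.2.1 y hyF ⟨lt_trans ha (EReal.coe_lt_coe_iff.mpr hy.1),
      lt_trans (EReal.coe_lt_coe_iff.mpr hy.2) hb⟩

end ContinuityOfEdges

/-! ### Resolvents and the distance to the spectrum -/

section ResolventNorm

variable {E : Type*} [NormedAddCommGroup E] [InnerProductSpace ℂ E]

theorem isResolventAt_resolvent {A : E →ₗ.[ℂ] E} {z : ℂ} (hz : z ∈ resolventSet A) :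
    IsResolventAt A z (resolvent A z) := by
  rw [resolvent, dif_pos hz]
  exact hz.choose_spec

/-- The first resolvent identity. -/
theorem IsResolventAt.sub_eq {A : E →ₗ.[ℂ] E} {z w : ℂ} {R S : E →L[ℂ] E}
    (hR : IsResolventAt A z R) (hS : IsResolventAt A w S) : R - S = (w - z) • (R * S) := by
  ext y
  obtain ⟨h, e⟩ := hS.1 y
  have h2 := hR.2 ⟨S y, h⟩
  have e2 : z • S y - A ⟨S y, h⟩ = y - (w - z) • S y := by
    rw [eq_sub_iff_add_eq, sub_smul]
    refine Eq.trans ?_ e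
    abel
  rw [e2, map_sub, map_smul] at h2
  change R y - S y = (w - z) • R (S y)
  rw [sub_eq_iff_eq_add, ← sub_eq_iff_eq_add']
  exact h2

theorem commute_resolvent {A : E →ₗ.[ℂ] E} {z w : ℂ} (hz : z ∈ resolventSet A) (hw : w ∈ resolventSet A) :
    Commute (resolvent A z) (resolvent A w) := by
  rcases eq_or_ne z w with rfl | hne
  · exact Commute.refl _
  have h1 := (isResolventAt_resolvent hz).sub_eq (isResolventAt_resolvent hw)
  have h2 := (isResolventAt_resolvent hw).sub_eq (isResolventAt_resolvent hz)
  rw [← neg_sub, h1, ← neg_smul, neg_sub] at h2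
  exact smul_right_injective _ (sub_ne_zero.mpr hne) h2

/-- Spectral mapping for the resolvent: a non-zero point `μ` of its spectrum is `(z - w)⁻¹` for
the point `w = z - μ⁻¹` of the spectrum of the operator. -/
theorem sub_inv_mem_spectrum {A : E →ₗ.[ℂ] E} {z μ : ℂ} (hz : z ∈ resolventSet A) (hμ : μ ≠ 0)
    (h : μ ∈ _root_.spectrum ℂ (resolvent A z)) : z - μ⁻¹ ∈ spectrum A := by
  intro hw
  have h1 := (isResolventAt_resolvent hz).sub_eq (isResolventAt_resolvent hw)
  have hc := commute_resolvent hz hw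
  set R := resolvent A z
  set S := resolvent A (z - μ⁻¹)
  have h2 : R * S = μ • (S - R) := by
    have : R - S = -(μ⁻¹ • (R * S)) := by rw [h1, ← neg_smul]; congr 1; ring
    rw [← neg_sub, this, neg_neg, smul_smul, mul_inv_cancel₀ hμ, one_smul]
  have h3 : S * R = μ • (S - R) := hc.eq ▸ h2
  -- With w = z - μ⁻¹, formally μ - R = μ(w - A)R, whose inverse is μ⁻¹(z - A)S = μ⁻¹(1 + μ⁻¹S).
  refine h (isUnit_iff_exists.mpr ⟨μ⁻¹ • (1 + μ⁻¹ • S), ?_, ?_⟩)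
  · rw [Algebra.algebraMap_eq_smul_one, sub_mul, smul_mul_assoc, one_mul, mul_smul_comm, mul_add,
      mul_smul_comm, mul_one, h2]
    simp only [smul_add, smul_sub, smul_smul]
    simp [hμ]
  · rw [Algebra.algebraMap_eq_smul_one, mul_sub, mul_smul_comm, mul_one, smul_mul_assoc, add_mul,
      smul_mul_assoc, one_mul, h3]
    simp only [smul_add, smul_sub, smul_smul]
    simp [hμ]

/-- The open disc of radius `‖R‖⁻¹` about a point of the resolvent set consists of such points. -/
theorem IsResolventAt.mem_resolventSet_of_norm_lt [CompleteSpace E] {A : E →ₗ.[ℂ] E} {z w : ℂ}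
    {R : E →L[ℂ] E} (hR : IsResolventAt A z R) (h : ‖z - w‖ * ‖R‖ < 1) : w ∈ resolventSet A := by
  have hsmall : ‖(z - w) • R‖ < 1 := by rwa [norm_smul]
  let S : (E →L[ℂ] E)ˣ := Units.oneSub _ hsmall
  have hS : ∀ y : E, (S : E →L[ℂ] E) y = y - (z - w) • R y := fun y => by
    simp [S]
  have hS₁ : ∀ y : E, (S : E →L[ℂ] E) ((↑S⁻¹ : E →L[ℂ] E) y) = y := fun y =>
    DFunLike.congr_fun (Units.mul_inv S) y
  have hS₂ : ∀ y : E, (↑S⁻¹ : E →L[ℂ] E) ((S : E →L[ℂ] E) y) = y := fun y =>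
    DFunLike.congr_fun (Units.inv_mul S) y
  refine ⟨R.comp (↑S⁻¹ : E →L[ℂ] E), fun y => ?_, fun x => ?_⟩
  · obtain ⟨hd, e⟩ := hR.1 ((↑S⁻¹ : E →L[ℂ] E) y)
    refine ⟨hd, ?_⟩
    have e' := hS₁ y
    rw [hS, sub_smul] at e'
    have e₂ := sub_eq_iff_eq_add.mp e
    change w • R ((↑S⁻¹ : E →L[ℂ] E) y) - A ⟨R ((↑S⁻¹ : E →L[ℂ] E) y), hd⟩ = y
    rw [e₂] at e'
    rw [← sub_eq_zero, ← sub_eq_zero.mpr e']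
    abel
  · have key : w • (x : E) - A x = (S : E →L[ℂ] E) (z • (x : E) - A x) := by
      rw [hS, hR.2 x, sub_smul]
      abel
    rw [ContinuousLinearMap.comp_apply, key, hS₂, hR.2 x]

/-- The linear map `z - A` on the domain of `A`. -/
noncomputable def subMap (A : E →ₗ.[ℂ] E) (z : ℂ) : A.domain →ₗ[ℂ] E :=
  z • A.domain.subtype - A.toFun

theorem subMap_apply (A : E →ₗ.[ℂ] E) (z : ℂ) (x : A.domain) : subMap A z x = z • (x : E) - A x := rfl

variable [CompleteSpace E] {A : E →ₗ.[ℂ] E}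

theorem inner_map_of_isSelfAdjoint (hA : IsSelfAdjoint A) (x y : A.domain) :
    inner ℂ (A x) (y : E) = inner ℂ (x : E) (A y) := by
  have h := LinearPMap.adjoint_isFormalAdjoint hA.dense_domain
  rw [LinearPMap.isSelfAdjoint_def.mp hA] at h
  exact h x y

/-- This is what A* = A adds to symmetry: a weak solution lies in the domain. -/
theorem exists_mem_domain_of_isSelfAdjoint (hA : IsSelfAdjoint A) {y w : E}
    (h : ∀ x : A.domain, inner ℂ w (x : E) = inner ℂ y (A x)) :
    ∃ hy : y ∈ A.domain, A ⟨y, hy⟩ = w := by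
  have key : ∃ hy : y ∈ A.adjoint.domain, A.adjoint ⟨y, hy⟩ = w :=
    ⟨LinearPMap.mem_adjoint_domain_of_exists y ⟨w, h⟩,
      LinearPMap.adjoint_apply_eq hA.dense_domain _ h⟩
  rwa [LinearPMap.isSelfAdjoint_def.mp hA] at key

/-- By symmetry ⟨x, Ax⟩ is real, so Im⟨x, (z - A)x⟩ = Im z · ‖x‖²; then Cauchy–Schwarz. -/
theorem im_mul_norm_le (hA : IsSelfAdjoint A) (z : ℂ) (x : A.domain) :
    |z.im| * ‖(x : E)‖ ≤ ‖z • (x : E) - A x‖ := by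
  have him : (inner ℂ (x : E) (A x)).im = 0 := by
    rw [← Complex.conj_eq_iff_im, inner_conj_symm]
    exact inner_map_of_isSelfAdjoint hA x x
  have h1 : (inner ℂ (x : E) (z • (x : E) - A x)).im = z.im * ‖(x : E)‖ ^ 2 := by
    have hs : inner ℂ (x : E) (x : E) = ((‖(x : E)‖ ^ 2 : ℝ) : ℂ) := by
      rw [inner_self_eq_norm_sq_to_K]
      exact (Complex.ofReal_pow _ _).symm
    rw [inner_sub_right, inner_smul_right, hs, Complex.sub_im, him, Complex.im_mul_ofReal, sub_zero]
  have h2 : |z.im| * ‖(x : E)‖ ^ 2 ≤ ‖(x : E)‖ * ‖z • (x : E) - A x‖ := by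
    calc |z.im| * ‖(x : E)‖ ^ 2 = |(inner ℂ (x : E) (z • (x : E) - A x)).im| := by
          rw [h1, abs_mul, abs_of_nonneg (sq_nonneg ‖(x : E)‖)]
      _ ≤ ‖inner ℂ (x : E) (z • (x : E) - A x)‖ := Complex.abs_im_le_norm _
      _ ≤ _ := norm_inner_le_norm _ _
  rcases (norm_nonneg (x : E)).eq_or_lt with h0 | h0
  · rw [← h0, mul_zero]
    positivity
  · nlinarith

theorem subMap_injective (hA : IsSelfAdjoint A) {z : ℂ} (hz : z.im ≠ 0) :
    Function.Injective (subMap A z) := by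
  refine (injective_iff_map_eq_zero _).mpr fun x hx => ?_
  have h := im_mul_norm_le hA z x
  rw [← subMap_apply, hx, norm_zero] at h
  have : ‖(x : E)‖ = 0 := by
    have := abs_pos.mpr hz
    nlinarith [norm_nonneg (x : E)]
  exact Subtype.ext (norm_eq_zero.mp this)

/-- The lower bound makes preimages of a convergent sequence Cauchy, and the weak equation for A
passes to the limit. -/
theorem isClosed_range_subMap (hA : IsSelfAdjoint A) {z : ℂ} (hz : z.im ≠ 0) :
    IsClosed ((subMap A z).range : Set E) := by
  refine IsSeqClosed.isClosed fun u y hu hy => ?_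
  choose x hx using hu
  have hcau : CauchySeq fun n => (x n : E) := by
    have hc := hy.cauchySeq
    rw [Metric.cauchySeq_iff'] at hc ⊢
    intro ε hε
    obtain ⟨N, hN⟩ := hc (|z.im| * ε) (mul_pos (abs_pos.mpr hz) hε)
    refine ⟨N, fun n hn => ?_⟩
    have h := im_mul_norm_le hA z (x n - x N)
    rw [← subMap_apply, map_sub, hx, hx, ← dist_eq_norm] at h
    have := h.trans_lt (hN n hn)
    rw [dist_eq_norm]
    exact lt_of_mul_lt_mul_left this (abs_nonneg _)
  obtain ⟨v, hv⟩ := cauchySeq_tendsto_of_complete hcau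
  obtain ⟨hvD, e⟩ := exists_mem_domain_of_isSelfAdjoint hA (y := v) (w := z • v - y) fun a => by
    have h1 : Tendsto (fun n => inner ℂ (z • (x n : E) - u n) (a : E)) atTop
        (𝓝 (inner ℂ (z • v - y) (a : E))) :=
      ((hv.const_smul z).sub hy).inner tendsto_const_nhds
    have h2 : Tendsto (fun n => inner ℂ (x n : E) (A a)) atTop (𝓝 (inner ℂ v (A a))) :=
      hv.inner tendsto_const_nhds
    refine tendsto_nhds_unique h1 (h2.congr fun n => ?_)
    rw [← inner_map_of_isSelfAdjoint hA, ← hx n, subMap_apply]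
    simp
  refine ⟨⟨v, hvD⟩, ?_⟩
  rw [subMap_apply, e]
  simp

/-- A vector orthogonal to the closed range is an eigenvector of A* = A for the non-real number z̄,
hence zero. -/
theorem subMap_surjective (hA : IsSelfAdjoint A) {z : ℂ} (hz : z.im ≠ 0) :
    Function.Surjective (subMap A z) := by
  rw [← LinearMap.range_eq_top]
  have := (isClosed_range_subMap hA hz).completeSpace_coe
  rw [← Submodule.orthogonal_eq_bot_iff, Submodule.eq_bot_iff]
  intro y hy
  obtain ⟨hyD, e⟩ := exists_mem_domain_of_isSelfAdjoint hA (y := y)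
    (w := (starRingEnd ℂ z) • y) fun x => by
    have h := (Submodule.mem_orthogonal' _ _).mp hy (subMap A z x) ⟨x, rfl⟩
    rw [subMap_apply, inner_sub_right, inner_smul_right, sub_eq_zero] at h
    rw [inner_smul_left, Complex.conj_conj, h]
  have h0 : subMap A (starRingEnd ℂ z) ⟨y, hyD⟩ = 0 := by
    rw [subMap_apply, e, sub_self]
  have h1 := subMap_injective hA (z := starRingEnd ℂ z) (by simpa using hz)
    (h0.trans (map_zero _).symm)
  exact congrArg Subtype.val h1

/-- Non-real numbers lie in the resolvent set of a self-adjoint operator. -/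
theorem mem_resolventSet_of_im_ne_zero (hA : IsSelfAdjoint A) {z : ℂ} (hz : z.im ≠ 0) :
    z ∈ resolventSet A := by
  let e := LinearEquiv.ofBijective (subMap A z) ⟨subMap_injective hA hz, subMap_surjective hA hz⟩
  have he : ∀ x, e x = z • (x : E) - A x := fun x => rfl
  refine ⟨(A.domain.subtype ∘ₗ e.symm.toLinearMap).mkContinuous |z.im|⁻¹ fun y => ?_,
    fun y => ⟨(e.symm y).2, ?_⟩, fun x => ?_⟩
  · have h := im_mul_norm_le hA z (e.symm y)
    rw [← he, e.apply_symm_apply] at h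
    rw [← div_eq_inv_mul, le_div_iff₀' (abs_pos.mpr hz)]
    exact h
  · exact (he (e.symm y)).symm.trans (e.apply_symm_apply y)
  · rw [← he]
    simp

theorem adjoint_resolvent (hA : IsSelfAdjoint A) {z : ℂ} (hz : z.im ≠ 0) :
    star (resolvent A z) = resolvent A (starRingEnd ℂ z) := by
  have hz' : (starRingEnd ℂ z).im ≠ 0 := by simpa using hz
  rw [ContinuousLinearMap.star_eq_adjoint, eq_comm, ContinuousLinearMap.eq_adjoint_iff]
  intro x y
  obtain ⟨hx, ex⟩ := (isResolventAt_resolvent (mem_resolventSet_of_im_ne_zero hA hz')).1 x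
  obtain ⟨hy, ey⟩ := (isResolventAt_resolvent (mem_resolventSet_of_im_ne_zero hA hz)).1 y
  have h := inner_map_of_isSelfAdjoint hA ⟨_, hx⟩ ⟨_, hy⟩
  conv_lhs => rw [← ey]
  conv_rhs => rw [← ex]
  rw [inner_sub_right, inner_sub_left, inner_smul_left, inner_smul_right, h, Complex.conj_conj]

theorem isStarNormal_resolvent (hA : IsSelfAdjoint A) {z : ℂ} (hz : z.im ≠ 0) :
    IsStarNormal (resolvent A z) := by
  refine ⟨?_⟩
  rw [adjoint_resolvent hA hz]
  exact commute_resolvent (mem_resolventSet_of_im_ne_zero hA (by simpa using hz))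
    (mem_resolventSet_of_im_ne_zero hA hz)

/-- The norm of the resolvent of a self-adjoint operator is the inverse of the distance to the
spectrum. -/
theorem ofReal_norm_resolvent (hA : IsSelfAdjoint A) {z : ℂ} (hz : z.im ≠ 0) :
    ENNReal.ofReal ‖resolvent A z‖ =
      (Metric.infEDist z (Complex.ofReal '' (realSpectrum A : Set ℝ)))⁻¹ := by
  have hzR := mem_resolventSet_of_im_ne_zero hA hz
  apply le_antisymm
  -- The zero resolvent is the trivial space, where no spectral value attains the spectral radius.
  · rcases eq_or_ne (resolvent A z) 0 with h0 | h0
    · simp [h0]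
    have : Nontrivial (E →L[ℂ] E) := ⟨_, _, h0⟩
    have := isStarNormal_resolvent hA hz
    obtain ⟨μ, hμ, hμn⟩ := spectrum.exists_nnnorm_eq_spectralRadius (resolvent A z)
    rw [IsStarNormal.spectralRadius_eq_nnnorm, ENNReal.coe_inj] at hμn
    have hμn' : ‖μ‖ = ‖resolvent A z‖ := congrArg NNReal.toReal hμn
    have hμ0 : μ ≠ 0 := by
      rw [← norm_pos_iff, hμn']
      exact norm_pos_iff.mpr h0
    have hmem := sub_inv_mem_spectrum hzR hμ0 hμ
    have him : (z - μ⁻¹).im = 0 := by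
      by_contra him
      exact hmem (mem_resolventSet_of_im_ne_zero hA him)
    have hre : (((z - μ⁻¹).re : ℝ) : ℂ) = z - μ⁻¹ := Complex.ext rfl (by rw [him]; rfl)
    rw [ENNReal.le_inv_iff_le_inv]
    have hmem' : z - μ⁻¹ ∈ Complex.ofReal '' (realSpectrum A : Set ℝ) := by
      refine ⟨(z - μ⁻¹).re, ?_, hre⟩
      change (((z - μ⁻¹).re : ℝ) : ℂ) ∈ spectrum A
      rwa [hre]
    refine (Metric.infEDist_le_edist_of_mem hmem').trans_eq ?_
    · rw [edist_dist, dist_eq_norm, sub_sub_cancel, norm_inv, hμn',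
        ENNReal.ofReal_inv_of_pos (norm_pos_iff.mpr h0)]
  · rw [ENNReal.inv_le_iff_inv_le, Metric.le_infEDist]
    rintro _ ⟨x, hx, rfl⟩
    rw [ENNReal.inv_le_iff_inv_le, edist_dist]
    by_contra! hlt
    refine hx ((isResolventAt_resolvent hzR).mem_resolventSet_of_norm_lt ?_)
    have hd : 0 < dist z (x : ℂ) := by
      refine dist_pos.mpr fun h => hz ?_
      rw [h, Complex.ofReal_im]
    rw [← ENNReal.ofReal_inv_of_pos hd, ENNReal.ofReal_lt_ofReal_iff (inv_pos.mpr hd)] at hlt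
    rw [← dist_eq_norm]
    exact (mul_lt_mul_of_pos_left hlt hd).trans_eq (mul_inv_cancel₀ hd.ne')

end ResolventNorm

end SpectralField

theorem mainTheorem2 {T : Type*} [tT : TopologicalSpace T] (H : T → Type*)
    [∀ t, NormedAddCommGroup (H t)] [∀ t, InnerProductSpace ℂ (H t)]
    [∀ t, CompleteSpace (H t)] (A : ∀ t, H t →ₗ.[ℂ] H t) (hA : ∀ t, IsSelfAdjoint (A t)) :
    List.TFAE [
      SpectralField.RContinuous A,
      Continuous[tT, SpectralField.fellTopology ℝ]
        (fun t => SpectralField.realSpectrum (A t)),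
      SpectralField.EdgesContinuous (fun t => (SpectralField.realSpectrum (A t) : Set ℝ))] := by
  -- Inversion is a homeomorphism of [0, ∞], which also covers empty spectrum: norm 0, distance ∞.
  have hnorm : ∀ z : ℂ, z.im ≠ 0 →
      (Continuous (fun t => ‖SpectralField.resolvent (A t) z‖) ↔ Continuous fun t =>
        Metric.infEDist z (Complex.ofReal '' (SpectralField.realSpectrum (A t) : Set ℝ))) := by
    intro z hz
    have he : ∀ t, Metric.infEDist z
        (Complex.ofReal '' (SpectralField.realSpectrum (A t) : Set ℝ)) =
        (ENNReal.ofReal ‖SpectralField.resolvent (A t) z‖)⁻¹ := fun t => by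
      rw [SpectralField.ofReal_norm_resolvent (hA t) hz, inv_inv]
    simp only [he]
    refine ⟨fun h => (ENNReal.continuous_ofReal.comp h).inv, fun h => ?_⟩
    have h' : Continuous fun t => ENNReal.ofReal ‖SpectralField.resolvent (A t) z‖ :=
      h.inv.congr fun t => inv_inv _
    refine ((ENNReal.continuousOn_toReal.comp_continuous h'
      fun t => ENNReal.ofReal_ne_top).congr fun t => ?_)
    exact ENNReal.toReal_ofReal (norm_nonneg _)
  tfae_have 1 → 2 := fun h =>
    SpectralField.continuous_fell_of_continuous_infEDist fun z hz => (hnorm z hz).mp (h z hz)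
  tfae_have 2 → 1 := fun h z hz =>
    (hnorm z hz).mpr (SpectralField.continuous_infEDist_of_continuous_fell h z)
  tfae_have 2 → 3 := SpectralField.edgesContinuous_of_continuous_fell
  tfae_have 3 → 2 := SpectralField.continuous_fell_of_edgesContinuous
  tfae_finish
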